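/- Let $\mathbb{F}$ be a field. An algebra is an $\mathbb{F}$-vector space with a bilinear multiplication (not assumed associative or unital), and morphisms of algebras are linear maps preserving the multiplication. A variety is the class of all algebras satisfying a given set of non-associative polynomial identities, viewed as a full subcategory of the category of algebras. A variety is *operadic* if it is determined by a set of multilinear identities, and *quadratic* if it is determined by a set of identities each of which is homogeneous of degree $2$ or homogeneous of degree $3$. A variety $\mathcal{V}$ is *action accessible* if for every object $X$ of $\mathcal{V}$, every split extension in $\mathcal{V}$ with kernel $X$ admits a morphism, in the category $\mathbf{SplExt}(X)$ of split extensions with kernel $X$ (whose morphisms are the morphisms of split extensions that are the identity on $X$), to a faithful one, i.e. to a subterminal object of $\mathbf{SplExt}(X)$. Consider the following varieties: $\mathbf{AbAlg}$ ($xy=0$); $\mathbf{Com}$ ($xy=yx$); $\mathbf{ACom}$ ($xy=-yx$); $\mathbf{CAssoc}$ ($xy=yx$ and $x(yz)=(xy)z$); $\mathbf{JJord}$ ($xy=yx$ and $x(yz)+y(zx)+z(xy)=0$); $\mathbf{Lie}$ ($xy=-yx$ and $x(yz)+y(zx)+z(xy)=0$); $\mathbf{ACAAssoc}$ ($xy=-yx$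 and $x(yz)=-(xy)z$); and $\mathbf{Nil}_2(\mathbf{Com})$, $\mathbf{Nil}_2(\mathbf{ACom})$, the subvarieties of $\mathbf{Com}$ and of $\mathbf{ACom}$ given by $(xy)z=0$ and $x(yz)=0$. **Corollary.** Let $\mathcal{V}$ be an action accessible, operadic, quadratic variety of algebras over $\mathbb{F}$, and suppose that $\mathcal{V}\neq\mathbf{AbAlg}$. 1. If $\mathcal{V}$ is commutative, i.e. $\mathcal{V}\subseteq\mathbf{Com}$, then $\mathcal{V}$ is one of $\mathbf{JJord}$, $\mathbf{CAssoc}$, $\mathbf{JJord}\cap\mathbf{CAssoc}$, $\mathbf{Nil}_2(\mathbf{Com})$. 2. If $\mathcal{V}$ is anti-commutative, i.e. $\mathcal{V}\subseteq\mathbf{ACom}$, then $\mathcal{V}$ is one of $\mathbf{Lie}$, $\mathbf{ACAAssoc}$, $\mathbf{Lie}\cap\mathbf{ACAAssoc}$, $\mathbf{Nil}_2(\mathbf{ACom})$. -/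

import Mathlib

open CategoryTheory CategoryTheory.Limits

universe u

/-! ### Action accessibility -/

section ActionAccessibility

universe v w

/-- A split extension with kernel `X` in a category with zero morphisms: a split epimorphism
`p : A ⟶ B` with a chosen section `s` and a kernel `k : X ⟶ A` of `p`. -/
structure SplitExt {C : Type w} [Category.{v} C] [HasZeroMorphisms C] (X : C) where
  A : C
  B : C
  k : X ⟶ A
  p : A ⟶ B
  s : B ⟶ A
  s_p : s ≫ p = 𝟙 B
  k_p : k ≫ p = 0
  isKernel : Nonempty (IsLimit (KernelFork.ofι k k_p))

namespace SplitExt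

variable {C : Type w} [Category.{v} C] [HasZeroMorphisms C] {X : C}

/-- A morphism of split extensions which is the identity on the kernel `X`. -/
@[ext]
structure Hom (E E' : SplitExt X) where
  a : E.A ⟶ E'.A
  b : E.B ⟶ E'.B
  k_a : E.k ≫ a = E'.k
  p_b : E.p ≫ b = a ≫ E'.p
  s_a : E.s ≫ a = b ≫ E'.s

/-- The category of split extensions with kernel `X`. -/
instance : Category (SplitExt X) where
  Hom E E' := Hom E E'
  id E := ⟨𝟙 _, 𝟙 _, by simp, by simp, by simp⟩
  comp {E E' E''} f g := ⟨f.a ≫ g.a, f.b ≫ g.b,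
    by rw [← Category.assoc, f.k_a, g.k_a],
    by rw [← Category.assoc, f.p_b, Category.assoc, g.p_b, Category.assoc],
    by rw [← Category.assoc, f.s_a, Category.assoc, g.s_a, Category.assoc]⟩
  id_comp f := Hom.ext (Category.id_comp f.a) (Category.id_comp f.b)
  comp_id f := Hom.ext (Category.comp_id f.a) (Category.comp_id f.b)
  assoc f g h := Hom.ext (Category.assoc f.a g.a h.a) (Category.assoc f.b g.b h.b)

end SplitExt

/-- A category is action accessible if, for every object `X`, every split extension with kernel
`X` admits a morphism to a faithful one, that is, to a subterminal object of the category of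
split extensions with kernel `X`. -/
def ActionAccessible (C : Type w) [Category.{v} C] [HasZeroMorphisms C] : Prop :=
  ∀ (X : C) (E : SplitExt X), ∃ E' : SplitExt X, IsSubterminal E' ∧ Nonempty (E ⟶ E')

end ActionAccessibility

/-! ### The category of non-associative algebras over a field -/

/-- A non-associative algebra over `F`: a vector space with a bilinear multiplication, which is
not assumed to be associative or to have a unit. -/
structure NAAlg (F : Type u) [Field F] where
  carrier : Type u
  [isRing : NonUnitalNonAssocRing carrier]
  [isModule : Module F carrier]
  [isScalarTower : IsScalarTower F carrier carrier]
  [smulCommClass : SMulCommClass F carrier carrier]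

namespace NAAlg

attribute [instance] NAAlg.isRing NAAlg.isModule NAAlg.isScalarTower NAAlg.smulCommClass

variable {F : Type u} [Field F]

instance : CoeSort (NAAlg F) (Type u) := ⟨NAAlg.carrier⟩

/-- A morphism of algebras: a linear map which preserves the multiplication. -/
@[ext]
structure Hom (A B : NAAlg F) where
  hom : A →ₙₐ[F] B

instance : Category (NAAlg F) where
  Hom A B := Hom A B
  id A := ⟨NonUnitalAlgHom.id F A⟩
  comp f g := ⟨g.hom.comp f.hom⟩

instance : HasZeroMorphisms (NAAlg F) where
  zero _ _ := ⟨⟨0⟩⟩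
  comp_zero _ _ := rfl
  zero_comp _ _ _ f := Hom.ext (NonUnitalAlgHom.ext fun _ => map_zero f.hom)

end NAAlg

/-! ### Identities and varieties

A non-associative polynomial on `S` is an element of `FreeNonUnitalNonAssocAlgebra F S`, the
magma algebra over `F` of the free magma on `S`. -/

namespace NAVariety

/-- The multiset of the variables that appear in a non-associative word. -/
def vars {S : Type u} : FreeMagma S → Multiset S
  | FreeMagma.of x => {x}
  | FreeMagma.mul a b => vars a + vars b

variable {F : Type u} [Field F]

/-- A polynomial is multilinear if there is one finite set `s` of variables such that in each of
its monomials every element of `s` appears exactly once and no other variable appears. -/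
def IsMultilinear {S : Type u} (φ : FreeNonUnitalNonAssocAlgebra F S) : Prop :=
  ∃ s : Finset S, ∀ w ∈ φ.coeff.support, vars w = s.val

/-- All monomials of the polynomial have degree `d`. -/
def HasDegree {S : Type u} (φ : FreeNonUnitalNonAssocAlgebra F S) (d : ℕ) : Prop :=
  ∀ w ∈ φ.coeff.support, w.length = d

/-- The algebra `A` satisfies the identity `φ`: all values of `φ` in `A` vanish. -/
def Satisfies (A : NAAlg F) {S : Type u} (φ : FreeNonUnitalNonAssocAlgebra F S) : Prop :=
  ∀ v : S → A, FreeNonUnitalNonAssocAlgebra.lift F v φ = 0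

/-- The variety of algebras determined by a set of identities. -/
def ofIdentities {S : Type u} (I : Set (FreeNonUnitalNonAssocAlgebra F S)) :
    ObjectProperty (NAAlg F) :=
  fun A => ∀ φ ∈ I, Satisfies A φ

/-- A class of algebras is an operadic variety if it is determined by a set of multilinear
identities. -/
def IsOperadic (V : ObjectProperty (NAAlg F)) : Prop :=
  ∃ (S : Type u) (I : Set (FreeNonUnitalNonAssocAlgebra F S)),
    (∀ φ ∈ I, IsMultilinear φ) ∧ V = ofIdentities I

/-- A variety is quadratic if it is determined by a set of identities, each of which is
homogeneous of degree two or homogeneous of degree three. -/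
def IsQuadratic (V : ObjectProperty (NAAlg F)) : Prop :=
  ∃ (S : Type u) (I : Set (FreeNonUnitalNonAssocAlgebra F S)),
    (∀ φ ∈ I, HasDegree φ 2 ∨ HasDegree φ 3) ∧ V = ofIdentities I

variable (F)

/-- Abelian algebras: `xy = 0`. -/
def AbAlg : ObjectProperty (NAAlg F) := fun A => ∀ x y : A, x * y = 0

/-- Commutative algebras: `xy = yx`. -/
def Com : ObjectProperty (NAAlg F) := fun A => ∀ x y : A, x * y = y * x

/-- Anti-commutative algebras: `xy = -yx`. -/
def ACom : ObjectProperty (NAAlg F) := fun A => ∀ x y : A, x * y = -(y * x)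

/-- Associative algebras: `x(yz) = (xy)z`. -/
def Assoc : ObjectProperty (NAAlg F) := fun A => ∀ x y z : A, x * (y * z) = (x * y) * z

/-- Anti-associative algebras: `x(yz) = -(xy)z`. -/
def AAssoc : ObjectProperty (NAAlg F) := fun A => ∀ x y z : A, x * (y * z) = -((x * y) * z)

/-- The Jacobi identity `x(yz) + y(zx) + z(xy) = 0`. -/
def Jacobi : ObjectProperty (NAAlg F) :=
  fun A => ∀ x y z : A, x * (y * z) + y * (z * x) + z * (x * y) = 0

/-- Commutative associative algebras. -/
def CAssoc : ObjectProperty (NAAlg F) := Com F ⊓ Assoc F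

/-- Anti-commutative anti-associative algebras. -/
def ACAAssoc : ObjectProperty (NAAlg F) := ACom F ⊓ AAssoc F

/-- Lie algebras: anti-commutativity and the Jacobi identity. -/
def Lie : ObjectProperty (NAAlg F) := ACom F ⊓ Jacobi F

/-- Jacobi--Jordan algebras: commutativity and the Jacobi identity. -/
def JJord : ObjectProperty (NAAlg F) := Com F ⊓ Jacobi F

variable {F}

/-- Two-step nilpotent algebras in `V`: those in which moreover `(xy)z = 0` and `x(yz) = 0`. -/
def Nil₂ (V : ObjectProperty (NAAlg F)) : ObjectProperty (NAAlg F) :=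
  fun A => V A ∧ ∀ x y z : A, (x * y) * z = 0 ∧ x * (y * z) = 0

end NAVariety

/-! Both cases are treated at once with the law `xy = ε yx`, where `ε = 1` or `ε = -1`.

Under this law every multilinear cubic word is a multiple of `x(yz)`, `y(zx)` or `z(xy)`, so a
multilinear cubic identity is a triple of coefficients, and the triples valid in `V` are stable
under permutation. If all valid triples are constant, they give nothing or Jacobi. If one is not
constant, differences make the three products equal, and only the sum of the coefficients matters:
either it always vanishes, or `x(yz) = 0`. This leaves four candidates (`eq_of_le_signedCom`). The
intersection in the statement is not a separate case: the cyclic law turns Jacobi into `3 x(yz) =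
0`, so it is the nilpotent variety, or in characteristic 3 the (anti-)associative one.

The multilinear identities defining `V` may have high degree, and the quadratic ones need not be
multilinear. The truncation `A ⊗ tF[t]/(t⁴)` links the two families: it kills words of degree above
3, yet homogeneous identities of degree 2 and 3 descend from it to `A` (`mem_of_cubic`).

Action accessibility excludes the largest candidate (`not_actionAccessible_signedCom`): there an
action on a line is any linear functional, so a product `e₀ e₁` may act as the identity while `e₀`
and `e₁` act as zero. -/

namespace NAAlg

variable {F : Type u} [Field F]

/-- The algebra on a vector space `M` whose multiplication is a given bilinear map. -/
def ofBilin (M : Type u) [AddCommGroup M] [Module F M] (μ : M →ₗ[F] M →ₗ[F] M) : NAAlg F :=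
  letI : NonUnitalNonAssocRing M :=
    { (inferInstance : AddCommGroup M) with
      mul := fun x y => μ x y
      left_distrib := fun x y z => map_add (μ x) y z
      right_distrib := fun x y z => LinearMap.map_add₂ μ x y z
      zero_mul := fun x => LinearMap.map_zero₂ μ x
      mul_zero := fun x => map_zero (μ x) }
  { carrier := M
    isScalarTower := ⟨fun a x y => LinearMap.map_smul₂ μ a x y⟩
    smulCommClass := ⟨fun a x y => ((μ x).map_smul a y).symm⟩ }

/-- The zero multiplication on the vector space `F`. -/
def line (F : Type u) [Field F] : NAAlg F := ofBilin F 0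

theorem line_mul (x y : line F) : x * y = 0 := rfl

variable (A : NAAlg F)

/-- The multiplication on `A ⊗ tF[t]/(t⁴)`, in coordinates with respect to `t, t², t³`. -/
def truncMul : (A × A × A) →ₗ[F] (A × A × A) →ₗ[F] (A × A × A) :=
  LinearMap.mk₂ F (fun x y => (0, x.1 * y.1, x.1 * y.2.1 + x.2.1 * y.1))
    (fun x y z => by ext <;> simp [add_mul]; abel)
    (fun c x y => by ext <;> simp [smul_mul_assoc])
    (fun x y z => by ext <;> simp [mul_add]; abel)
    (fun c x y => by ext <;> simp [mul_smul_comm])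

/-- The algebra `A ⊗ tF[t]/(t⁴)`. -/
def trunc : NAAlg F := ofBilin (A × A × A) (truncMul A)

variable {A}

/-- The element `a t + b t² + c t³` of the truncation. -/
def trunc.mk (a b c : A) : trunc A := ((a, b, c) : A × A × A)

/-- The coefficients, as a linear map. -/
def trunc.coords : trunc A ≃ₗ[F] A × A × A := LinearEquiv.refl F (A × A × A)

@[simp] theorem trunc.coords_mk (a b c : A) : trunc.coords (trunc.mk a b c) = (a, b, c) := rfl

@[simp] theorem trunc.coords_mul (x y : trunc A) : trunc.coords (x * y) =
    (0, (trunc.coords x).1 * (trunc.coords y).1,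
      (trunc.coords x).1 * (trunc.coords y).2.1 + (trunc.coords x).2.1 * (trunc.coords y).1) := rfl

theorem trunc.ext {x y : trunc A} (h : trunc.coords x = trunc.coords y) : x = y := h

end NAAlg

/-! ### Words of low degree and their values -/

namespace NAVariety

open NAAlg

variable {F : Type u} [Field F]

theorem lift_eq_sum {A : NAAlg F} {S : Type u} (φ : FreeNonUnitalNonAssocAlgebra F S)
    (v : S → A) : FreeNonUnitalNonAssocAlgebra.lift F v φ =
      ∑ w ∈ φ.coeff.support, φ.coeff w • FreeMagma.lift v w := rfl

theorem card_vars {S : Type u} (w : FreeMagma S) : (vars w).card = w.length := by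
  induction w with
  | ih1 x => simp [vars, FreeMagma.length]
  | ih2 a b ha hb =>
    change (vars a + vars b).card = a.length + b.length
    rw [Multiset.card_add, ha, hb]

theorem exists_of_length_one {S : Type u} {w : FreeMagma S} (h : w.length = 1) :
    ∃ x, w = .of x := by
  cases w with
  | of x => exact ⟨x, rfl⟩
  | mul a b =>
    change a.length + b.length = 1 at h
    have := a.length_pos
    have := b.length_pos
    omega

theorem exists_of_length_two {S : Type u} {w : FreeMagma S} (h : w.length = 2) :
    ∃ x y, w = .of x * .of y := by
  cases w with
  | of x => simp [FreeMagma.length] at h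
  | mul a b =>
    change a.length + b.length = 2 at h
    have := a.length_pos
    have := b.length_pos
    obtain ⟨x, rfl⟩ := exists_of_length_one (w := a) (by omega)
    obtain ⟨y, rfl⟩ := exists_of_length_one (w := b) (by omega)
    exact ⟨x, y, rfl⟩

theorem exists_of_length_three {S : Type u} {w : FreeMagma S} (h : w.length = 3) :
    ∃ x y z, w = .of x * (.of y * .of z) ∨ w = (.of x * .of y) * .of z := by
  cases w with
  | of x => simp [FreeMagma.length] at h
  | mul a b =>
    change a.length + b.length = 3 at h
    have := a.length_pos
    have := b.length_pos
    obtain ha | ha : a.length = 1 ∨ a.length = 2 := by omega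
    · obtain ⟨x, rfl⟩ := exists_of_length_one ha
      obtain ⟨y, z, rfl⟩ := exists_of_length_two (w := b) (by omega)
      exact ⟨x, y, z, .inl rfl⟩
    · obtain ⟨x, y, rfl⟩ := exists_of_length_two ha
      obtain ⟨z, rfl⟩ := exists_of_length_one (w := b) (by omega)
      exact ⟨x, y, z, .inr rfl⟩

theorem lift_word_eq_zero_of_abelian {A : NAAlg F} (hA : AbAlg F A) {S : Type u} (v : S → A)
    {w : FreeMagma S} (h : w.length ≠ 1) : FreeMagma.lift v w = 0 := by
  cases w with
  | of x => exact absurd rfl h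
  | mul a b => exact hA _ _

theorem abAlg_le_of_isQuadratic {V : ObjectProperty (NAAlg F)} (hV : IsQuadratic V) :
    AbAlg F ≤ V := by
  obtain ⟨S, I, hI, rfl⟩ := hV
  intro A hA φ hφ v
  rw [lift_eq_sum]
  refine Finset.sum_eq_zero fun w hw => ?_
  have : w.length ≠ 1 := by
    rcases hI φ hφ with h | h <;> rw [h w hw] <;> decide
  rw [lift_word_eq_zero_of_abelian hA v this, smul_zero]

/-- Each letter is divisible by `t`, so a word of length `n` is divisible by `tⁿ`. The three
coordinates are handled together because the `t³` coefficient of a product involves the lower ones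
of its factors. -/
theorem lift_trunc_word {A : NAAlg F} {S : Type u} (v : S → trunc A) (w : FreeMagma S) :
    (1 < w.length → (trunc.coords (FreeMagma.lift v w)).1 = 0) ∧
    (2 < w.length → (trunc.coords (FreeMagma.lift v w)).2.1 = 0) ∧
    (3 < w.length → (trunc.coords (FreeMagma.lift v w)).2.2 = 0) := by
  induction w with
  | ih1 x => simp [FreeMagma.length]
  | ih2 a b ha hb =>
    have pa := a.length_pos
    have pb := b.length_pos
    change (1 < a.length + b.length → _) ∧ (2 < a.length + b.length → _) ∧
      (3 < a.length + b.length → _)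
    rw [map_mul, trunc.coords_mul]
    refine ⟨fun _ => rfl, fun h => ?_, fun h => ?_⟩
    · obtain h | h : 1 < a.length ∨ 1 < b.length := by omega
      · simp [ha.1 h]
      · simp [hb.1 h]
    · have h1 : 1 < a.length ∨ 2 < b.length := by omega
      have h2 : 2 < a.length ∨ 1 < b.length := by omega
      rcases h1 with h1 | h1 <;> rcases h2 with h2 | h2 <;>
        simp [ha.1, ha.2.1, hb.1, hb.2.1, h1, h2]

theorem lift_trunc_word_eq_zero {A : NAAlg F} {S : Type u} (v : S → trunc A) {w : FreeMagma S}
    (h : 3 < w.length) : FreeMagma.lift v w = 0 := by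
  obtain ⟨h1, h2, h3⟩ := lift_trunc_word v w
  exact trunc.ext (Prod.ext (h1 (by omega)) (Prod.ext (h2 (by omega)) (h3 h)))

/-- A homogeneous identity of degree two or three passes from the truncation of `A` to `A`. -/
theorem satisfies_of_satisfies_trunc {A : NAAlg F} {S : Type u}
    {φ : FreeNonUnitalNonAssocAlgebra F S} (hφ : HasDegree φ 2 ∨ HasDegree φ 3)
    (h : Satisfies (trunc A) φ) : Satisfies A φ := by
  intro v
  -- At the elements `v x · t`, a word of length `d ≤ 3` takes its value in `A` times `tᵈ`; the
  -- identity is read off in that coordinate.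
  have h0 := congrArg trunc.coords (h fun x => trunc.mk (v x) 0 0)
  rw [lift_eq_sum, map_sum, map_zero] at h0
  rw [lift_eq_sum]
  rcases hφ with hφ | hφ
  · have h1 := congrArg (fun p : A × A × A => p.2.1) h0
    simp only [Prod.snd_sum, Prod.fst_sum] at h1
    refine Eq.trans (Finset.sum_congr rfl fun w hw => ?_) h1
    obtain ⟨x, y, rfl⟩ := exists_of_length_two (hφ w hw)
    simp
  · have h1 := congrArg (fun p : A × A × A => p.2.2) h0
    simp only [Prod.snd_sum] at h1
    refine Eq.trans (Finset.sum_congr rfl fun w hw => ?_) h1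
    obtain ⟨x, y, z, rfl | rfl⟩ := exists_of_length_three (hφ w hw) <;> simp

/-- The identity `xy = ε yx`. -/
def SignedCom (ε : F) : ObjectProperty (NAAlg F) := fun A => ∀ x y : A, x * y = ε • (y * x)

/-- The identity `α x(yz) + β y(zx) + γ z(xy) = 0`. -/
def Cubic (α β γ : F) : ObjectProperty (NAAlg F) := fun A => ∀ x y z : A,
  α • (x * (y * z)) + β • (y * (z * x)) + γ • (z * (x * y)) = 0

theorem signedCom_trunc {ε : F} {A : NAAlg F} (hA : SignedCom ε A) : SignedCom ε (trunc A) := by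
  intro x y
  apply trunc.ext
  rw [map_smul]
  ext
  · simp
  · simpa using hA _ _
  · simp only [trunc.coords_mul, Prod.smul_snd, smul_add]
    rw [hA, hA (trunc.coords x).2.1, add_comm]

theorem cubic_trunc {α β γ : F} {A : NAAlg F} (hA : Cubic α β γ A) :
    Cubic α β γ (trunc A) := by
  intro x y z
  apply trunc.ext
  simp only [map_add, map_smul]
  ext
  · simp
  · simp
  · simpa using hA _ _ _

/-- In the presence of `xy = ε yx`, every multilinear word in `x, y` is a multiple of `xy`. -/
theorem exists_coeff_of_vars_pair (ε : F) {S : Type u} {x y : S} {w : FreeMagma S}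
    (hw : vars w = {x, y}) : ∃ α : F, ∀ A : NAAlg F, SignedCom ε A → ∀ v : S → A,
      FreeMagma.lift v w = α • (v x * v y) := by
  have hl := card_vars w
  rw [hw] at hl
  obtain ⟨a, b, rfl⟩ := exists_of_length_two (hl.symm.trans (by simp))
  have hp : [a, b].Perm [x, y] := Multiset.coe_eq_coe.mp hw
  have : (a = x ∧ b = y) ∨ (a = y ∧ b = x) := by
    have hm := List.mem_permutations.2 hp
    simp [List.permutations, List.permutationsAux, List.permutationsAux.rec,
      List.permutationsAux2] at hm
    tauto
  rcases this with ⟨rfl, rfl⟩ | ⟨rfl, rfl⟩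
  · exact ⟨1, fun A _ v => by simp⟩
  · exact ⟨ε, fun A hA v => by simpa using hA _ _⟩

theorem eq_of_perm_triple {S : Type u} {a b c x y z : S} (h : [a, b, c].Perm [x, y, z]) :
    (a = x ∧ b = y ∧ c = z) ∨ (a = x ∧ b = z ∧ c = y) ∨ (a = y ∧ b = z ∧ c = x) ∨
      (a = y ∧ b = x ∧ c = z) ∨ (a = z ∧ b = x ∧ c = y) ∨ (a = z ∧ b = y ∧ c = x) := by
  have hm := List.mem_permutations.2 h
  simp [List.permutations, List.permutationsAux, List.permutationsAux.rec,
    List.permutationsAux2] at hm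
  tauto

/-- The coefficients are chosen before the algebra, so an identity of `V` and its test in another
algebra involve the same triple. -/
theorem exists_coeff_of_vars_triple (ε : F) {S : Type u} {x y z : S}
    {w : FreeMagma S} (hw : vars w = {x, y, z}) :
    ∃ α β γ : F, ∀ A : NAAlg F, SignedCom ε A → ∀ v : S → A, FreeMagma.lift v w =
      α • (v x * (v y * v z)) + β • (v y * (v z * v x)) + γ • (v z * (v x * v y)) := by
  have hl := card_vars w
  rw [hw] at hl
  have key : ∀ a b c : S, vars w = {a, b, c} →
      ∃ α β γ : F, ∀ A : NAAlg F, SignedCom ε A → ∀ v : S → A, v a * (v b * v c) =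
      α • (v x * (v y * v z)) + β • (v y * (v z * v x)) + γ • (v z * (v x * v y)) := by
    intro a b c h
    have hp : [a, b, c].Perm [x, y, z] := Multiset.coe_eq_coe.mp (h.symm.trans hw)
    rcases eq_of_perm_triple hp with ⟨rfl, rfl, rfl⟩ | ⟨rfl, rfl, rfl⟩ | ⟨rfl, rfl, rfl⟩ | ⟨rfl, rfl, rfl⟩ |
      ⟨rfl, rfl, rfl⟩ | ⟨rfl, rfl, rfl⟩
    · exact ⟨1, 0, 0, fun A _ v => by simp⟩
    · exact ⟨ε, 0, 0, fun A hA v => by simp [hA (v b) (v c), mul_smul_comm]⟩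
    · exact ⟨0, 1, 0, fun A _ v => by simp⟩
    · exact ⟨0, ε, 0, fun A hA v => by simp [hA (v b) (v c), mul_smul_comm]⟩
    · exact ⟨0, 0, 1, fun A _ v => by simp⟩
    · exact ⟨0, 0, ε, fun A hA v => by simp [hA (v b) (v c), mul_smul_comm]⟩
  obtain ⟨a, b, c, rfl | rfl⟩ := exists_of_length_three (hl.symm.trans (by simp))
  · exact key a b c rfl
  -- The word `(ab)c` equals `ε c(ab)`.
  · obtain ⟨α, β, γ, h⟩ := key c a b (by
      change ({a} + {b} + {c} : Multiset S) = {c} + ({a} + {b})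
      abel)
    refine ⟨ε * α, ε * β, ε * γ, fun A hA v => ?_⟩
    have := h A hA v
    simp only [map_mul, FreeMagma.lift_of]
    rw [hA, this]
    simp only [smul_add, mul_smul]

theorem exists_coeff_of_isMultilinear_pair (ε : F) {S : Type u} {x y : S}
    {φ : FreeNonUnitalNonAssocAlgebra F S} (hφ : ∀ w ∈ φ.coeff.support, vars w = {x, y}) :
    ∃ α : F, ∀ A : NAAlg F, SignedCom ε A → ∀ v : S → A,
      FreeNonUnitalNonAssocAlgebra.lift F v φ = α • (v x * v y) := by
  choose! α h using fun w hw => exists_coeff_of_vars_pair ε (hφ w hw)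
  refine ⟨∑ w ∈ φ.coeff.support, φ.coeff w * α w, fun A hA v => ?_⟩
  rw [lift_eq_sum, Finset.sum_smul]
  exact Finset.sum_congr rfl fun w hw => by rw [h w hw A hA, mul_smul]

theorem exists_coeff_of_isMultilinear_triple (ε : F) {S : Type u} {x y z : S}
    {φ : FreeNonUnitalNonAssocAlgebra F S} (hφ : ∀ w ∈ φ.coeff.support, vars w = {x, y, z}) :
    ∃ α β γ : F, ∀ A : NAAlg F, SignedCom ε A → ∀ v : S → A,
      FreeNonUnitalNonAssocAlgebra.lift F v φ =
        α • (v x * (v y * v z)) + β • (v y * (v z * v x)) + γ • (v z * (v x * v y)) := by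
  choose! α β γ h using fun w hw => exists_coeff_of_vars_triple ε (hφ w hw)
  refine ⟨∑ w ∈ φ.coeff.support, φ.coeff w * α w, ∑ w ∈ φ.coeff.support, φ.coeff w * β w,
    ∑ w ∈ φ.coeff.support, φ.coeff w * γ w, fun A hA v => ?_⟩
  rw [lift_eq_sum, Finset.sum_smul, Finset.sum_smul, Finset.sum_smul, ← Finset.sum_add_distrib,
    ← Finset.sum_add_distrib]
  exact Finset.sum_congr rfl fun w hw => by rw [h w hw A hA, smul_add, smul_add]; simp only [mul_smul]

end NAVariety

/-! ### Classification by cubic identities -/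

namespace NAVariety

open NAAlg

variable {F : Type u} [Field F]

/-- An operadic quadratic variety of (anti-)commutative algebras is determined inside all such
algebras by its cubic identities `α x(yz) + β y(zx) + γ z(xy) = 0`. -/
theorem mem_of_cubic {ε : F} {V : ObjectProperty (NAAlg F)} (operadic : IsOperadic V)
    (quadratic : IsQuadratic V) (nonabelian : V ≠ AbAlg F) (hV : V ≤ SignedCom ε)
    {A : NAAlg F} (hA : SignedCom ε A)
    (h : ∀ α β γ : F, V ≤ Cubic α β γ → Cubic α β γ A) : V A := by
  have hab := abAlg_le_of_isQuadratic quadratic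
  -- Membership of the truncation is tested on the multilinear identities; the return to `A` uses
  -- the quadratic ones.
  suffices hB : V (trunc A) by
    obtain ⟨S, I, hI, rfl⟩ := quadratic
    exact fun φ hφ => satisfies_of_satisfies_trunc (hI φ hφ) (hB φ hφ)
  obtain ⟨S, I, hI, hVI⟩ := operadic
  have hVs : ∀ {C : NAAlg F}, V C → ∀ φ ∈ I, Satisfies C φ := fun {C} hC => by
    rw [hVI] at hC; exact hC
  have hAB := signedCom_trunc hA
  rw [hVI]
  intro φ hφ v
  classical
  obtain ⟨s, hs⟩ := hI φ hφ
  have hlen : ∀ w ∈ φ.coeff.support, w.length = s.card := fun w hw => by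
    rw [← card_vars, hs w hw, Finset.card_val]
  obtain hc | hc | hc | hc | hc : s.card = 0 ∨ s.card = 1 ∨ s.card = 2 ∨ s.card = 3 ∨
    3 < s.card := by omega
  · rw [lift_eq_sum]
    refine Finset.sum_eq_zero fun w hw => ?_
    have := w.length_pos
    have := hlen w hw
    omega
  · obtain ⟨x, rfl⟩ := Finset.card_eq_one.mp hc
    have hw : ∀ w ∈ φ.coeff.support, w = .of x := fun w hw => by
      obtain ⟨y, rfl⟩ := exists_of_length_one ((hlen w hw).trans hc)
      have : ({y} : Multiset S) = {x} := hs _ hw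
      rw [Multiset.singleton_inj.mp this]
    -- The line is abelian, hence in `V`, and evaluation at `1` isolates the coefficient of the only
    -- possible word.
    have hl := hVs (hab (line F) fun _ _ => rfl) φ hφ fun _ => (show line F from (1 : F))
    rw [lift_eq_sum] at hl ⊢
    refine Finset.sum_eq_zero fun w hwm => ?_
    have h1 : φ.coeff.support = {w} := Finset.eq_singleton_iff_unique_mem.mpr
      ⟨hwm, fun w' hw' => (hw w' hw').trans (hw w hwm).symm⟩
    rw [h1, Finset.sum_singleton, hw w hwm] at hl
    have h2 : φ.coeff (.of x) * (1 : F) = 0 := hl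
    rw [mul_one] at h2
    rw [hw w hwm, h2, zero_smul]
  · obtain ⟨x, y, hxy, rfl⟩ := Finset.card_eq_two.mp hc
    have hval : ({x, y} : Finset S).val = {x, y} := by simp [hxy]
    obtain ⟨α, hα⟩ := exists_coeff_of_isMultilinear_pair ε fun w hw => (hs w hw).trans hval
    have hα0 : α = 0 := by
      -- A nonzero coefficient would force `xy = 0` throughout `V`.
      by_contra hne
      refine nonabelian (le_antisymm (fun C hC a b => ?_) hab)
      have := hVs hC φ hφ fun i => if i = x then a else b
      rw [hα C (hV C hC)] at this
      simpa [hxy.symm, hne] using this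
    rw [hα _ hAB, hα0, zero_smul]
  · obtain ⟨x, y, z, hxy, hxz, hyz, rfl⟩ := Finset.card_eq_three.mp hc
    have hval : ({x, y, z} : Finset S).val = {x, y, z} := by simp [hxy, hxz, hyz]
    obtain ⟨α, β, γ, hα⟩ :=
      exists_coeff_of_isMultilinear_triple ε fun w hw => (hs w hw).trans hval
    rw [hα _ hAB]
    refine cubic_trunc (h α β γ fun C hC a b c => ?_) _ _ _
    have := hVs hC φ hφ fun i => if i = x then a else if i = y then b else c
    rw [hα C (hV C hC)] at this
    simpa [hxy.symm, hxz.symm, hyz.symm] using this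
  · rw [lift_eq_sum]
    refine Finset.sum_eq_zero fun w hw => ?_
    rw [lift_trunc_word_eq_zero v (hc.trans_eq (hlen w hw).symm), smul_zero]

/-- Swapping two variables in a cubic identity. -/
theorem cubic_swap {ε α β γ : F} (hε : ε * ε = 1) {A : NAAlg F} (hA : SignedCom ε A)
    (h : Cubic α β γ A) : Cubic β α γ A := by
  intro x y z
  have := congrArg (ε • ·) (h y x z)
  simp only [smul_zero] at this
  rw [hA x z, hA z y, hA y x] at this
  rw [← this]
  simp only [mul_smul_comm, smul_add, smul_smul]
  rw [show ε * (α * ε) = α by linear_combination α * hε,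
    show ε * (β * ε) = β by linear_combination β * hε,
    show ε * (γ * ε) = γ by linear_combination γ * hε]
  abel

theorem cubic_rotate {α β γ : F} {A : NAAlg F} (h : Cubic α β γ A) : Cubic γ α β A := by
  intro x y z
  rw [← h y z x]
  abel

/-- The difference of the two identities is `(α - β)(x(yz) - y(zx))`. -/
theorem cubic_sub {α β γ : F} {A : NAAlg F} (h : Cubic α β γ A) (h' : Cubic β α γ A)
    (hne : α ≠ β) : Cubic 1 (-1) 0 A := by
  intro x y z
  have hd : (α - β) • (x * (y * z) - y * (z * x)) = 0 := by
    have := congrArg₂ (· - ·) (h x y z) (h' x y z)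
    simp only [sub_zero] at this
    rw [← this]
    module
  have := (smul_eq_zero.mp hd).resolve_left (sub_ne_zero.mpr hne)
  rw [← this]
  module

/-- All three cyclic products coincide, so the identity depends on the sum of its coefficients
alone. -/
theorem cubic_of_cyclic {A : NAAlg F} (hA : Cubic (1 : F) (-1) 0 A) (α β γ : F) (x y z : A) :
    α • (x * (y * z)) + β • (y * (z * x)) + γ • (z * (x * y)) =
      (α + β + γ) • (x * (y * z)) := by
  have h1 : x * (y * z) = y * (z * x) := by
    have := hA x y z
    rw [← sub_eq_zero, ← this]
    module
  have h2 : y * (z * x) = z * (x * y) := by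
    have := hA y z x
    rw [← sub_eq_zero, ← this]
    module
  rw [← h2, ← h1]
  module

/-- The operadic quadratic varieties of (anti-)commutative algebras. -/
theorem eq_of_le_signedCom {ε : F} (hε : ε * ε = 1) {V : ObjectProperty (NAAlg F)}
    (operadic : IsOperadic V) (quadratic : IsQuadratic V) (nonabelian : V ≠ AbAlg F)
    (hV : V ≤ SignedCom ε) :
    V = SignedCom ε ∨ V = SignedCom ε ⊓ Cubic 1 1 1 ∨ V = SignedCom ε ⊓ Cubic 1 (-1) 0 ∨
      V = SignedCom ε ⊓ Cubic 1 0 0 := by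
  have mem {A : NAAlg F} := mem_of_cubic operadic quadratic nonabelian hV (A := A)
  by_cases hN : V ≤ Cubic 1 0 0
  · refine .inr (.inr (.inr (le_antisymm (le_inf hV hN) fun A hA => mem hA.1 ?_)))
    intro α β γ _ x y z
    have h0 : ∀ a b c : A, a * (b * c) = 0 := fun a b c => by simpa using hA.2 a b c
    simp [h0]
  by_cases hC : V ≤ Cubic 1 (-1) 0
  · refine .inr (.inr (.inl (le_antisymm (le_inf hV hC) fun A hA => mem hA.1 ?_)))
    intro α β γ hT x y z
    rw [cubic_of_cyclic hA.2]
    -- A nonzero sum would give `x(yz) = 0` in `V`, the case already removed.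
    have : α + β + γ = 0 := by
      by_contra hne
      refine hN fun C hVC a b c => ?_
      have := hT C hVC a b c
      rw [cubic_of_cyclic (hC C hVC)] at this
      simpa [hne] using this
    rw [this, zero_smul]
  -- Two unequal coefficients can be rotated into the first two places; `cubic_sub` then yields the
  -- excluded cyclic law.
  have heq : ∀ α β γ : F, V ≤ Cubic α β γ → α = β ∧ γ = α := by
    intro α β γ hT
    constructor <;> by_contra hne <;> refine hC fun C hVC => ?_
    · exact cubic_sub (hT C hVC) (cubic_swap hε (hV C hVC) (hT C hVC)) hne
    · exact cubic_sub (cubic_rotate (hT C hVC))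
        (cubic_swap hε (hV C hVC) (cubic_rotate (hT C hVC))) hne
  by_cases hJ : V ≤ Cubic 1 1 1
  · refine .inr (.inl (le_antisymm (le_inf hV hJ) fun A hA => mem hA.1 ?_))
    intro α β γ hT x y z
    obtain ⟨rfl, rfl⟩ := heq α β γ hT
    have := hA.2 x y z
    simp only [one_smul] at this
    rw [← smul_add, ← smul_add, this, smul_zero]
  · refine .inl (le_antisymm hV fun A hA => mem hA ?_)
    intro α β γ hT x y z
    obtain ⟨rfl, rfl⟩ := heq α β γ hT
    have : γ = 0 := by
      by_contra hne
      refine hJ fun C hVC a b c => ?_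
      have := hT C hVC a b c
      rw [← smul_add, ← smul_add] at this
      simpa only [one_smul] using (smul_eq_zero.mp this).resolve_left hne
    simp [this]

end NAVariety

/-! ### Kernels in full subcategories of algebras -/

namespace NAAlg

variable {F : Type u} [Field F]

/-- A multiplicative linear map as a morphism of algebras. -/
def homOfLinear {M N : Type u} [AddCommGroup M] [Module F M] [AddCommGroup N] [Module F N]
    {μ : M →ₗ[F] M →ₗ[F] M} {ν : N →ₗ[F] N →ₗ[F] N} (f : M →ₗ[F] N)
    (hf : ∀ x y, f (μ x y) = ν (f x) (f y)) : ofBilin M μ ⟶ ofBilin N ν :=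
  ⟨{ toFun := f
     map_smul' := f.map_smul
     map_zero' := f.map_zero
     map_add' := f.map_add
     map_mul' := hf }⟩

/-- The morphism into `K` induced along an injective `k : K ⟶ A` by a morphism into `A` with
values in the image of `k`. -/
noncomputable def liftOfInjective {K A W : NAAlg F} (k : K ⟶ A)
    (hk : Function.Injective k.hom) (g : W ⟶ A) (hg : ∀ w, ∃ x, k.hom x = g.hom w) : W ⟶ K :=
  ⟨{ toFun := fun w => (hg w).choose
     map_smul' := fun c w => hk (by
      rw [(hg _).choose_spec, map_smul, map_smul]
      exact congrArg (c • ·) (hg w).choose_spec.symm)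
     map_zero' := hk (by rw [(hg _).choose_spec, map_zero, map_zero])
     map_add' := fun v w => hk (by
      rw [(hg _).choose_spec, map_add, map_add, (hg _).choose_spec, (hg _).choose_spec])
     map_mul' := fun v w => hk (by
      rw [(hg _).choose_spec, map_mul, map_mul, (hg _).choose_spec, (hg _).choose_spec]) }⟩

/-- In a full subcategory of algebras, an injective morphism onto the set-theoretic kernel is a
kernel. -/
theorem nonempty_isLimit_kernelFork {V : ObjectProperty (NAAlg F)} {K A B : V.FullSubcategory}
    (k : K ⟶ A) (p : A ⟶ B) (w : k ≫ p = 0) (hk : Function.Injective k.hom.hom)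
    (hp : ∀ a, p.hom.hom a = 0 → ∃ x, k.hom.hom x = a) :
    Nonempty (IsLimit (KernelFork.ofι k w)) := by
  have hg {W : V.FullSubcategory} (g : W ⟶ A) (hgp : g ≫ p = 0) (w : W.obj) :
      ∃ x, k.hom.hom x = g.hom.hom w :=
    hp _ (congrArg (fun f : W ⟶ B => f.hom.hom w) hgp)
  refine ⟨KernelFork.IsLimit.ofι k w
    (fun g hgp => ⟨liftOfInjective k.hom hk g.hom (hg g hgp)⟩) (fun g hgp => ?_)
    (fun g hgp m hm => ?_)⟩
  · apply InducedCategory.hom_ext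
    apply NAAlg.Hom.ext
    ext w
    exact (hg g hgp w).choose_spec
  · apply InducedCategory.hom_ext
    apply NAAlg.Hom.ext
    ext w
    apply hk
    exact (congrArg (fun f : _ ⟶ A => f.hom.hom w) hm).trans (hg g hgp w).choose_spec.symm

end NAAlg

/-! ### Failure of action accessibility for all (anti-)commutative algebras -/

namespace NAVariety

open NAAlg

variable {F : Type u} [Field F]

section ScalarExtension

variable (ε : F) {M : Type u} [AddCommGroup M] [Module F M] (μ : M →ₗ[F] M →ₗ[F] M)
  (ρ : M →ₗ[F] F)

/-- The semidirect product multiplication on `M × F` for the action of `M` on the line through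
the functional `ρ`. -/
def semidirectMul : (M × F) →ₗ[F] (M × F) →ₗ[F] (M × F) :=
  LinearMap.mk₂ F (fun a b => (μ a.1 b.1, ρ a.1 * b.2 + ε * (a.2 * ρ b.1)))
    (fun x y z => by ext <;> simp; ring)
    (fun c x y => by ext <;> simp; ring)
    (fun x y z => by ext <;> simp; ring)
    (fun c x y => by ext <;> simp; ring)

variable {ε μ}

theorem signedCom_ofBilin (hμ : ∀ x y, μ x y = ε • μ y x) : SignedCom ε (ofBilin M μ) := hμ

theorem signedCom_semidirect (hε : ε * ε = 1) (hμ : ∀ x y, μ x y = ε • μ y x) :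
    SignedCom ε (ofBilin (M × F) (semidirectMul ε μ ρ)) :=
  signedCom_ofBilin fun x y => Prod.ext (hμ x.1 y.1) (by
    simp only [semidirectMul, LinearMap.mk₂_apply, Prod.smul_snd, smul_eq_mul]
    linear_combination (- ρ x.1 * y.2) * hε)

variable (ε) in
/-- The line with zero multiplication, as an object of `SignedCom ε`. -/
def lineObj : (SignedCom ε).FullSubcategory :=
  ⟨line F, fun x y => by rw [line_mul, line_mul, smul_zero]⟩

/-- The split extension of `M` by the line given by the functional `ρ`. -/
def scalarExt (hε : ε * ε = 1) (hμ : ∀ x y, μ x y = ε • μ y x) : SplitExt (lineObj ε) where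
  A := ⟨_, signedCom_semidirect ρ hε hμ⟩
  B := ⟨_, signedCom_ofBilin hμ⟩
  k := ⟨homOfLinear (LinearMap.inr F M F) fun x y => by simp [semidirectMul]⟩
  p := ⟨homOfLinear (LinearMap.fst F M F) fun x y => by simp [semidirectMul]⟩
  s := ⟨homOfLinear (LinearMap.inl F M F) fun x y => by simp [semidirectMul]⟩
  s_p := rfl
  k_p := rfl
  isKernel := nonempty_isLimit_kernelFork _ _ _ (fun x y h => congrArg Prod.snd h)
    fun a ha => ⟨a.2, Prod.ext (Eq.symm ha) rfl⟩

end ScalarExtension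

variable (ε : F)

/-- The multiplication on `F³` with `e₀ e₁ = e₂`, `e₁ e₀ = ε e₂`, all other products of basis
vectors being zero. -/
def heisenbergMul : (F × F × F) →ₗ[F] (F × F × F) →ₗ[F] (F × F × F) :=
  LinearMap.mk₂ F (fun a b => (0, 0, a.1 * b.2.1 + ε * (a.2.1 * b.1)))
    (fun x y z => by ext <;> simp; ring)
    (fun c x y => by ext <;> simp; ring)
    (fun x y z => by ext <;> simp; ring)
    (fun c x y => by ext <;> simp; ring)

variable {ε}

theorem heisenbergMul_comm (hε : ε * ε = 1) (x y : F × F × F) :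
    heisenbergMul ε x y = ε • heisenbergMul ε y x := by
  ext <;> simp [heisenbergMul]
  linear_combination (- x.1 * y.2.1) * hε

/-- The split extension of the Heisenberg-type algebra by the line, where `e₂` acts as the
identity and `e₀`, `e₁` act as zero. -/
def heisenbergExt (hε : ε * ε = 1) : SplitExt (lineObj ε) :=
  scalarExt (LinearMap.snd F F F ∘ₗ LinearMap.snd F F (F × F)) hε (heisenbergMul_comm hε)

/-- The split extension of the line by the line with trivial action. -/
def trivialExt (hε : ε * ε = 1) : SplitExt (lineObj ε) :=
  scalarExt (M := F) (μ := 0) 0 hε fun _ _ => by simp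

/-- The inclusion of the span of `e₀`. -/
def trivialToHeisenberg (hε : ε * ε = 1) : trivialExt hε ⟶ heisenbergExt hε where
  a := ⟨homOfLinear (LinearMap.prodMap (LinearMap.inl F F (F × F)) LinearMap.id) fun x y => by
    simp [semidirectMul, heisenbergMul]; rfl⟩
  b := ⟨homOfLinear (LinearMap.inl F F (F × F)) fun x y => by simp [heisenbergMul]; rfl⟩
  k_a := rfl
  p_b := rfl
  s_a := rfl

/-- The morphism out of the trivial extension which is zero on the quotient. -/
def trivialToAny (hε : ε * ε = 1) (E : SplitExt (lineObj ε)) : trivialExt hε ⟶ E where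
  a := (⟨homOfLinear (LinearMap.snd F F F) fun x y => by simp [semidirectMul]⟩ :
    (trivialExt hε).A ⟶ lineObj ε) ≫ E.k
  b := 0
  k_a := by
    rw [← Category.assoc]
    exact Category.id_comp E.k
  p_b := by rw [Category.assoc, E.k_p, comp_zero, comp_zero]
  s_a := by
    rw [← Category.assoc, zero_comp]
    exact zero_comp

variable (ε) in
/-- A scalar as an element of the line. -/
def lineObj.mk (x : F) : (lineObj ε).obj := x

/-- A vector of `F³` as an element of the quotient of `heisenbergExt`. -/
def heisenbergExt.mkB (hε : ε * ε = 1) (x : F × F × F) : (heisenbergExt hε).B.obj := x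

/-- A vector of `F³ × F` as an element of the total algebra of `heisenbergExt`. -/
def heisenbergExt.mkA (hε : ε * ε = 1) (x : (F × F × F) × F) : (heisenbergExt hε).A.obj := x

/-- The variety of all (anti-)commutative algebras is not action accessible. -/
theorem not_actionAccessible_signedCom (hε : ε * ε = 1) :
    ¬ ActionAccessible (SignedCom ε).FullSubcategory := by
  intro h
  obtain ⟨E, hE, ⟨f⟩⟩ := h (lineObj ε) (heisenbergExt hε)
  -- Since `e₀` acts as zero, the trivial extension reaches `E` both through `e₀` and through `0`.
  -- Subterminality identifies the two, so `f` kills `e₀`, hence also `e₂ = e₀ e₁`.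
  have hfg : trivialToHeisenberg hε ≫ f = trivialToAny hε E := IsSubterminal.def.mp hE _ _
  have h0 : f.b.hom.hom (heisenbergExt.mkB hε (1, 0, 0)) = 0 :=
    congrArg (fun g : trivialExt hε ⟶ E => g.b.hom.hom (show F from 1)) hfg
  have h2 : f.b.hom.hom (heisenbergExt.mkB hε (0, 0, 1)) = 0 := by
    have hm := map_mul f.b.hom.hom (heisenbergExt.mkB hε (1, 0, 0)) (heisenbergExt.mkB hε (0, 1, 0))
    rw [h0, zero_mul] at hm
    rw [← hm]
    congr 1
    change ((0, 0, 1) : F × F × F) = (0, 0, 1 * 1 + ε * (0 * 0))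
    simp
  have hs : f.a.hom.hom (heisenbergExt.mkA hε ((0, 0, 1), 0)) = 0 := by
    have := congrArg (fun g : (heisenbergExt hε).B ⟶ E.A =>
      g.hom.hom (heisenbergExt.mkB hε (0, 0, 1))) f.s_a
    exact this.trans ((congrArg E.s.hom.hom h2).trans (map_zero _))
  -- The product of `e₂` with the generator of the line is that generator, so killing `e₂` kills the
  -- line, although `E.k` is monic.
  have hk : E.k.hom.hom (lineObj.mk ε 1) = 0 := by
    have hm := map_mul f.a.hom.hom (heisenbergExt.mkA hε ((0, 0, 1), 0))
      (heisenbergExt.mkA hε (0, 1))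
    rw [hs, zero_mul] at hm
    have hka := congrArg (fun g : lineObj ε ⟶ E.A => g.hom.hom (lineObj.mk ε 1)) f.k_a
    rw [← hm]
    refine hka.symm.trans (congrArg f.a.hom.hom ?_)
    change (((0, 0, 0), 1) : (F × F × F) × F) =
      ((0, 0, 0 * 0 + ε * (0 * 0)), 1 * 1 + ε * (0 * 0))
    simp
  have hk0 : E.k = 0 := by
    apply InducedCategory.hom_ext
    apply NAAlg.Hom.ext
    ext x
    have := map_smul E.k.hom.hom (show F from x) (lineObj.mk ε 1)
    rw [hk, smul_zero] at this
    refine Eq.trans (congrArg E.k.hom.hom ?_) this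
    exact (mul_one (show F from x)).symm
  obtain ⟨hl⟩ := E.isKernel
  have hid : 𝟙 (lineObj ε) = 0 := Fork.IsLimit.hom_ext hl (by
    change 𝟙 _ ≫ E.k = 0 ≫ E.k
    rw [hk0, comp_zero, comp_zero])
  exact one_ne_zero (α := F)
    (congrArg (fun g : lineObj ε ⟶ lineObj ε => g.hom.hom (show F from 1)) hid)

end NAVariety

/-! ### Translation to the named varieties -/

namespace NAVariety

variable {F : Type u} [Field F]

theorem signedCom_one : SignedCom (1 : F) = Com F := by
  funext A
  simp only [SignedCom, Com, one_smul]

theorem signedCom_neg_one : SignedCom (-1 : F) = ACom F := by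
  funext A
  simp only [SignedCom, ACom, neg_smul, one_smul]

theorem cubic_jacobi : Cubic (1 : F) 1 1 = Jacobi F := by
  funext A
  simp only [Cubic, Jacobi, one_smul]

/-- In this form, rewriting `z(xy)` as `±(xy)z` gives associativity or anti-associativity directly.
-/
theorem cubic_cyclic_iff {A : NAAlg F} :
    Cubic (1 : F) (-1) 0 A ↔ ∀ x y z : A, x * (y * z) = z * (x * y) := by
  simp only [Cubic, one_smul, neg_smul, zero_smul, add_zero, ← sub_eq_add_neg, sub_eq_zero]
  exact ⟨fun h x y z => (h z x y).symm, fun h x y z => (h y z x).symm⟩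

theorem com_inf_cubic_cyclic : Com F ⊓ Cubic 1 (-1) 0 = CAssoc F := by
  funext A
  refine propext (and_congr_right fun hA => cubic_cyclic_iff.trans ?_)
  exact forall₃_congr fun x y z => by rw [hA z (x * y)]

theorem acom_inf_cubic_cyclic : ACom F ⊓ Cubic 1 (-1) 0 = ACAAssoc F := by
  funext A
  refine propext (and_congr_right fun hA => cubic_cyclic_iff.trans ?_)
  exact forall₃_congr fun x y z => by rw [hA z (x * y)]

theorem com_inf_cubic_nil : Com F ⊓ Cubic 1 0 0 = Nil₂ (Com F) := by
  funext A
  refine propext (and_congr_right fun hA => ?_)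
  simp only [Cubic, one_smul, zero_smul, add_zero]
  exact ⟨fun h x y z => ⟨by rw [hA, h], h x y z⟩, fun h x y z => (h x y z).2⟩

theorem acom_inf_cubic_nil : ACom F ⊓ Cubic 1 0 0 = Nil₂ (ACom F) := by
  funext A
  refine propext (and_congr_right fun hA => ?_)
  simp only [Cubic, one_smul, zero_smul, add_zero]
  exact ⟨fun h x y z => ⟨by rw [hA, h, neg_zero], h x y z⟩, fun h x y z => (h x y z).2⟩

end NAVariety

theorem mainTheorem7 (F : Type u) [Field F] (V : ObjectProperty (NAAlg F))
    (operadic : NAVariety.IsOperadic V) (quadratic : NAVariety.IsQuadratic V)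
    (accessible : ActionAccessible V.FullSubcategory)
    (nonabelian : V ≠ NAVariety.AbAlg F) :
    (V ≤ NAVariety.Com F →
      V = NAVariety.JJord F ∨ V = NAVariety.CAssoc F ∨
        V = NAVariety.JJord F ⊓ NAVariety.CAssoc F ∨
        V = NAVariety.Nil₂ (NAVariety.Com F)) ∧
    (V ≤ NAVariety.ACom F →
      V = NAVariety.Lie F ∨ V = NAVariety.ACAAssoc F ∨
        V = NAVariety.Lie F ⊓ NAVariety.ACAAssoc F ∨
        V = NAVariety.Nil₂ (NAVariety.ACom F)) := by

  have key (ε : F) (hε : ε * ε = 1) (hV : V ≤ NAVariety.SignedCom ε) :=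
    (NAVariety.eq_of_le_signedCom hε operadic quadratic nonabelian hV).resolve_left fun h =>
      NAVariety.not_actionAccessible_signedCom hε (h ▸ accessible)
  constructor
  · intro hV
    rw [← NAVariety.signedCom_one] at hV
    rcases key 1 (by ring) hV with h | h | h <;>
      rw [NAVariety.signedCom_one] at h
    · exact .inl (h.trans (by rw [NAVariety.cubic_jacobi]; rfl))
    · exact .inr (.inl (h.trans NAVariety.com_inf_cubic_cyclic))
    · exact .inr (.inr (.inr (h.trans NAVariety.com_inf_cubic_nil)))
  · intro hV
    rw [← NAVariety.signedCom_neg_one] at hV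
    rcases key (-1) (by ring) hV with h | h | h <;>
      rw [NAVariety.signedCom_neg_one] at h
    · exact .inl (h.trans (by rw [NAVariety.cubic_jacobi]; rfl))
    · exact .inr (.inl (h.trans NAVariety.acom_inf_cubic_cyclic))
    · exact .inr (.inr (.inr (h.trans NAVariety.acom_inf_cubic_nil)))
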